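/- A sequence $(x_1,\dots,x_m)$ of non-negative integers is a parking function if its weakly increasing rearrangement $(z_1,\dots,z_m)$ satisfies $z_i\le i-1$ for $i=1,\dots,m$. For integers $n\ge 1$ and $c$, let $\widehat{\mathrm{PF}}_{n,c}$ be the set of all $(x_1,\dots,x_n)\in\mathbb{Z}_n^n$ such that $(x_1,\dots,x_{n-1})$ (read with entries in $\{0,\dots,n-1\}$) is a parking function and $x_1+\cdots+x_n\equiv c \pmod n$. The symmetric group $S_n$ acts on $\widehat{\mathrm{PF}}_{n,c}$ by the action $\tau_{n,c}$: a permutation $\pi$ sends $(x_1,\dots,x_n)$ to $(y+x_{\pi(1)},\dots,y+x_{\pi(n)})$, where $y$ is the unique element of $\mathbb{Z}_n$ for which $(y+x_{\pi(1)},\dots,y+x_{\pi(n-1)})$ is a parking function. For $d\mid n$ put $f_n(d)=\tfrac12$ if $d$ is even and $n/d$ is odd, and $f_n(d)=1$ otherwise. For positive integers $m,e$ put $$F(m,e)=\sum_{d\mid m}\mu\!\left(\frac md\right) f_{me}(d)\,d^2,$$ where $\mu$ is the Möbius function, and let $J_2(m)=m^2\prod_{p\mid m,\ p\text{ prime}}\left(1-\frac1{p^2}\right)$.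 Theorem. For every integer $n\ge 1$, the number $o_{n,n}$ of orbits of $\widehat{\mathrm{PF}}_{n,n}$ under the action $\tau_{n,n}$ is $$o_{n,n}=\frac1{n^2}\sum_{e\mid n}\binom{2e-1}{e}\,F\!\left(\frac ne,e\right).$$ Moreover, for all positive integers $m,e$, $$F(m,e)=\begin{cases}J_2(m) & \text{if } e \text{ is even or } m \text{ is odd},\\ \tfrac13 J_2(m) & \text{if } e \text{ is odd and } m \text{ is even}.\end{cases}$$ -/

import Mathlib

/-- `(x₁, …, x_m)` (here indexed by `0, …, m - 1`) is a parking function if its weakly increasing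
rearrangement `(z₁, …, z_m)` satisfies `z_i ≤ i - 1` for `i = 1, …, m`. -/
def IsParkingFunction {m : ℕ} (x : Fin m → ℕ) : Prop :=
  ∀ i : Fin m, (x ∘ Tuple.sort x) i ≤ i

/-- The first `n - 1` coordinates of `x ∈ ℤ_n^n`, read as integers in `{0, …, n - 1}`. -/
def initialPart {n : ℕ} (x : Fin n → ZMod n) : Fin (n - 1) → ℕ :=
  fun i => (x (Fin.castLE (Nat.sub_le n 1) i)).val

/-- The set of all `(x₁, …, x_n) ∈ ℤ_n^n` such that `(x₁, …, x_{n-1})` is a parking function and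
`x₁ + ⋯ + x_n = c` modulo `n`. -/
def extendedPF (n c : ℕ) : Set (Fin n → ZMod n) :=
  {x | IsParkingFunction (initialPart x) ∧ ∑ i, x i = (c : ZMod n)}

theorem isParkingFunction_iff_card {m : ℕ} (x : Fin m → ℕ) :
    IsParkingFunction x ↔ ∀ k ≤ m, k ≤ (Finset.univ.filter fun i => x i < k).card := by
  constructor
  · intro h k hk
    have h1 : (Finset.univ.filter fun j : Fin m => (j : ℕ) < k).card = k := by
      rw [Fin.card_filter_val_lt, min_eq_right hk]
    calc k = (Finset.univ.filter fun j : Fin m => (j : ℕ) < k).card := h1.symm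
      _ ≤ _ := by
        apply Finset.card_le_card_of_injOn (Tuple.sort x)
        · intro j hj
          simp only [Finset.coe_filter, Finset.mem_univ, true_and, Set.mem_ofPred_eq] at hj ⊢
          exact lt_of_le_of_lt (h j) hj
        · exact (Tuple.sort x).injective.injOn
  · intro h j
    by_contra hj
    push Not at hj
    have h1 := h (j + 1) j.isLt
    have h2 : (Finset.univ.filter fun i => x i < (j : ℕ) + 1).card ≤
        (Finset.univ.filter fun l : Fin m => (l : ℕ) < j).card := by
      apply Finset.card_le_card_of_injOn (Tuple.sort x).symm
      · intro i hi
        simp only [Finset.coe_filter, Finset.mem_univ, true_and, Set.mem_ofPred_eq] at hi ⊢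
        by_contra hl
        push Not at hl
        have h3 := Tuple.monotone_sort x (show j ≤ (Tuple.sort x).symm i from hl)
        simp only [Function.comp_apply, Equiv.apply_symm_apply] at h3 hj
        omega
      · exact (Tuple.sort x).symm.injective.injOn
    rw [Fin.card_filter_val_lt, min_eq_right j.isLt.le] at h2
    omega

/-- Number of `i` with `g i - z ∈ {0, …, k - 1}`, as a sum of multiplicities. -/
theorem card_val_sub_lt {ι : Type*} [Fintype ι] {n : ℕ} [NeZero n] (g : ι → ZMod n) (z : ZMod n)
    (k : ℕ) (hk : k ≤ n) :
    (Finset.univ.filter fun i => (g i - z).val < k).card =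
      ∑ s ∈ Finset.range k, (Finset.univ.filter fun i => g i = z + (s : ZMod n)).card := by
  classical
  induction k with
  | zero => simp
  | succ k ih =>
    rw [Finset.sum_range_succ, ← ih (by omega), ← Finset.card_union_of_disjoint]
    · congr 1
      ext i
      simp only [Finset.mem_filter, Finset.mem_univ, true_and, Finset.mem_union]
      rw [Nat.lt_succ_iff_lt_or_eq]
      refine or_congr_right ?_
      rw [← sub_eq_iff_eq_add']
      constructor
      · intro h
        rw [← h, ZMod.natCast_zmod_val]
      · intro h
        rw [h, ZMod.val_natCast_of_lt (by omega)]
    · rw [Finset.disjoint_left]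
      intro i hi hi'
      simp only [Finset.mem_filter, Finset.mem_univ, true_and] at hi hi'
      rw [hi', add_sub_cancel_left, ZMod.val_natCast_of_lt (by omega)] at hi
      omega

/-- For every sequence of `n - 1` residues modulo `n`, exactly one of its translates is a parking
function. -/
theorem existsUnique_shift {n : ℕ} [NeZero n] (g : Fin (n - 1) → ZMod n) :
    ∃! y : ZMod n, IsParkingFunction fun i => (y + g i).val := by
  classical
  have hn : 0 < n := Nat.pos_of_neZero n
  let a : ZMod n → ℤ := fun z => ((Finset.univ.filter fun i => g i = z).card : ℤ)
  let S : ℕ → ℤ := fun t => ∑ s ∈ Finset.range t, (a (s : ZMod n) - 1)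
  have hadd : ∀ z k : ℕ, S (z + k) = S z + ∑ s ∈ Finset.range k, (a ((z : ZMod n) + s) - 1) := by
    intro z k
    simp only [S, Finset.sum_range_add, Nat.cast_add]
  have hSn : S n = -1 := by
    have h := card_val_sub_lt g 0 n le_rfl
    have h1 : (Finset.univ.filter fun i => (g i - 0).val < n) = Finset.univ := by
      ext i
      simpa using ZMod.val_lt (g i)
    rw [h1, Finset.card_univ, Fintype.card_fin] at h
    have h2 : ∑ s ∈ Finset.range n, a (s : ZMod n) = (n : ℤ) - 1 := by
      have h3 : ((n - 1 : ℕ) : ℤ) = ∑ s ∈ Finset.range n, a (s : ZMod n) := by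
        rw [h]
        push_cast
        simp [a]
      rw [← h3]
      omega
    simp only [S, Finset.sum_sub_distrib, h2]
    simp
  have hper : ∀ t, S (n + t) = S t - 1 := by
    intro t
    rw [hadd, hSn]
    simp only [CharP.cast_eq_zero, zero_add, S]
    ring
  have key : ∀ z : ℕ, (IsParkingFunction fun i => (-(z : ZMod n) + g i).val) ↔
      ∀ k ≤ n - 1, S z ≤ S (z + k) := by
    intro z
    rw [isParkingFunction_iff_card]
    refine forall_congr' fun k => forall_congr' fun hk => ?_
    have h := card_val_sub_lt g (z : ZMod n) k (by omega)
    simp only [sub_eq_neg_add] at h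
    rw [h, hadd]
    have h4 : ∑ s ∈ Finset.range k, (a ((z : ZMod n) + s) - 1) =
        ((∑ s ∈ Finset.range k,
          (Finset.univ.filter fun i => g i = (z : ZMod n) + (s : ZMod n)).card : ℕ) : ℤ) - k := by
      rw [Finset.sum_sub_distrib]
      push_cast
      simp [a]
    rw [h4]
    omega
  have hne : (Finset.range n).Nonempty := ⟨0, by simpa using hn⟩
  have hex : ∃ z, z < n ∧ ∀ t < n, S z ≤ S t := by
    obtain ⟨z, hz, hmin⟩ := Finset.exists_min_image (Finset.range n) S hne
    exact ⟨z, by simpa using hz, fun t ht => hmin t (by simpa using ht)⟩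
  obtain ⟨hzn, hzmin⟩ := Nat.find_spec hex
  have hfirst : ∀ t < Nat.find hex, S (Nat.find hex) < S t := by
    intro t ht
    have h := Nat.find_min hex ht
    by_contra hcon
    push Not at hcon
    exact h ⟨ht.trans hzn, fun u hu => hcon.trans (hzmin u hu)⟩
  generalize Nat.find hex = z at hzn hzmin hfirst
  refine ⟨-(z : ZMod n), ?_, ?_⟩
  · refine (key z).2 fun k hk => ?_
    by_cases hlt : z + k < n
    · exact hzmin _ hlt
    · have h1 := hfirst (z + k - n) (by omega)
      have h2 := hper (z + k - n)
      rw [show n + (z + k - n) = z + k by omega] at h2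
      omega
  · intro y hy
    have hyz : y = -(((-y).val : ℕ) : ZMod n) := by
      rw [ZMod.natCast_zmod_val, neg_neg]
    have hw : (-y).val < n := ZMod.val_lt _
    rw [hyz] at hy ⊢
    generalize (-y).val = w at hw hy
    have hkey := (key w).1 hy
    rcases lt_trichotomy w z with h | h | h
    · have h1 := hfirst w h
      have h2 := hkey (z - w) (by omega)
      rw [show w + (z - w) = z by omega] at h2
      omega
    · rw [h]
    · have h1 := hzmin w hw
      have h2 := hkey (n - (w - z)) (by omega)
      rw [show w + (n - (w - z)) = n + z by omega, hper] at h2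
      omega

theorem existsUnique_shift_perm {n : ℕ} [NeZero n] (π : Equiv.Perm (Fin n)) (x : Fin n → ZMod n) :
    ∃! y : ZMod n, IsParkingFunction (initialPart fun i => y + x (π i)) :=
  existsUnique_shift fun i => x (π (Fin.castLE (Nat.sub_le n 1) i))

/-- The unique `y ∈ ℤ_n` such that `(y + x_{π(1)}, …, y + x_{π(n-1)})` is a parking function. -/
noncomputable def parkingShift {n : ℕ} [NeZero n] (π : Equiv.Perm (Fin n)) (x : Fin n → ZMod n) :
    ZMod n :=
  (existsUnique_shift_perm π x).choose

theorem sum_shift_perm {n : ℕ} (π : Equiv.Perm (Fin n)) (x : Fin n → ZMod n) (y : ZMod n) :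
    ∑ i, (y + x (π i)) = ∑ i, x i := by
  rw [Finset.sum_add_distrib, Equiv.sum_comp π x]
  simp

/-- The map `τ`: a permutation `π` sends `(x₁, …, x_n)` to `(y + x_{π(1)}, …, y + x_{π(n)})`, where
`y ∈ ℤ_n` is the unique element making the first `n - 1` coordinates a parking function. -/
noncomputable def tau {n c : ℕ} [NeZero n] (π : Equiv.Perm (Fin n)) (x : extendedPF n c) :
    extendedPF n c :=
  ⟨fun i => parkingShift π x.1 + x.1 (π i),
    (existsUnique_shift_perm π x.1).choose_spec.1, by rw [sum_shift_perm]; exact x.2.2⟩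

theorem tau_eq {n c : ℕ} [NeZero n] (π : Equiv.Perm (Fin n)) (x x' : extendedPF n c) (y : ZMod n)
    (h : ∀ i, x'.1 i = y + x.1 (π i)) : tau π x = x' := by
  have hfun : x'.1 = fun i => y + x.1 (π i) := funext h
  have hy : y = parkingShift π x.1 :=
    (existsUnique_shift_perm π x.1).choose_spec.2 y (by
      have := x'.2.1
      rwa [hfun] at this)
  apply Subtype.ext
  rw [hfun, hy]
  rfl

/-- `τ` is an action of the symmetric group. Since `π` acts by `x ↦ (x_{π(1)}, …, x_{π(n)})` up to
translation, acting first by `σ` and then by `π` is acting by `σ ∘ π`; with Mathlib's convention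
for products of permutations this is a left action of the opposite group. -/
noncomputable instance tauAction (n c : ℕ) [NeZero n] :
    MulAction (Equiv.Perm (Fin n))ᵐᵒᵖ (extendedPF n c) where
  smul π x := tau π.unop x
  one_smul x := tau_eq _ x x 0 (by simp)
  mul_smul a b x := tau_eq _ x _
    (parkingShift a.unop (tau b.unop x).1 + parkingShift b.unop x.1) (fun i => by
      change parkingShift a.unop (tau b.unop x).1 +
        (parkingShift b.unop x.1 + x.1 (b.unop (a.unop i))) = _
      rw [add_assoc]
      rfl)

/-- The number of orbits of the action `τ` of the symmetric group on `extendedPF n c`. -/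
noncomputable def orbitCount (n c : ℕ) [NeZero n] : ℕ :=
  Nat.card (MulAction.orbitRel.Quotient (Equiv.Perm (Fin n))ᵐᵒᵖ (extendedPF n c))

/-- The function `f_n` on the divisors `d` of `n`: it is `1/2` if `d` is even and `n / d` is odd, and
`1` otherwise. -/
def divisorWeight (n d : ℕ) : ℚ :=
  if Even d ∧ Odd (n / d) then 1 / 2 else 1

/-- `F(m, e) = ∑_{d ∣ m} μ(m / d) f_{me}(d) d²`. -/
def weightedJordan (m e : ℕ) : ℚ :=
  ∑ d ∈ m.divisors, (ArithmeticFunction.moebius (m / d) : ℚ) * divisorWeight (m * e) d * (d : ℚ) ^ 2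

/-- The Jordan totient function `J₂(m) = m² ∏_{p ∣ m} (1 - 1 / p²)`. -/
def jordanTotientTwo (m : ℕ) : ℚ :=
  (m : ℚ) ^ 2 * ∏ p ∈ m.primeFactors, (1 - 1 / (p : ℚ) ^ 2)

/-!
Taking the multiset of entries identifies the orbits of `τ` on `extendedPF n n` with the orbits of
`ℤ_n`, acting by translation, on the multisets of `n` elements of `ℤ_n` with sum `0`
(`orbitCount_eq_card_translation_orbits`): every translation class of sequences contains an element
whose first `n - 1` entries form a parking function, and `τ` acts by permutations up to translation.

The orbits are counted by Burnside's lemma. A multiset fixed by a translation of order `d` is the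
pullback of a multiset of `e = n / d` elements of `ℤ_e`. If the latter has sum `s`, the pullback has
sum `d s + n e (d - 1) / 2`, so it has sum `0` exactly when `s = 0`, unless `d` is even and `e` is odd,
in which case it never does (`pullbackMultiplicity_mem_iff`). The multisets of `e` elements of `ℤ_e`
with sum `0` are counted by additive characters: if `ψ(k)` has order `r`, then
`∏ₐ (1 - ψ(k a) X) = (1 - X ^ r) ^ (e / r)`, and reading off the coefficient of `X ^ e` in the inverse
gives `e⁻¹ ∑_{r ∣ e} φ(r) C(2 e / r - 1, e / r)` (`card_zeroSumMultisets_mul`).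

Collecting the terms with `n / (d r) = g` fixed, the coefficient of `C(2 g - 1, g)` is
`∑ d φ(d) φ(m / d)`, where `m = n / g` and `d` runs over the divisors of `m` other than those with `d`
even and `n / d` odd. This is `F(m, g)` (`weightedJordan_eq_sum_totient`), since both sums equal `J₂(m)`
when no divisor is exceptional, and `J₂(m) / 3` otherwise.
-/

/-! ### The Jordan totient as a Dirichlet convolution -/

section JordanTotient

open ArithmeticFunction

/-- The Jordan totient `J₂ = μ * (d ↦ d²)` as a Dirichlet convolution. -/
def jordanConv : ArithmeticFunction ℚ :=
  (moebius : ArithmeticFunction ℚ) * (pow 2 : ArithmeticFunction ℕ)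

/-- Euler's totient as a rational arithmetic function. -/
def totientArith : ArithmeticFunction ℚ := ⟨fun d => (d.totient : ℚ), by simp⟩


theorem isMultiplicative_jordanConv : jordanConv.IsMultiplicative :=
  isMultiplicative_moebius.intCast.mul isMultiplicative_pow.natCast

theorem jordanConv_apply (m : ℕ) :
    jordanConv m = ∑ d ∈ m.divisors, (moebius (m / d) : ℚ) * (d : ℚ) ^ 2 := by
  rw [jordanConv, mul_apply,
    Nat.sum_divisorsAntidiagonal' (f := fun a b => (moebius : ArithmeticFunction ℚ) a *
      ((pow 2 : ArithmeticFunction ℕ) : ArithmeticFunction ℚ) b)]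
  refine Finset.sum_congr rfl fun d _ => ?_
  simp [pow_apply]

theorem jordanConv_prime_pow {p : ℕ} (hp : p.Prime) (k : ℕ) :
    jordanConv (p ^ (k + 1)) = ((p : ℚ) ^ (k + 1)) ^ 2 * (1 - 1 / (p : ℚ) ^ 2) := by
  have hp0 : (p : ℚ) ≠ 0 := by exact_mod_cast hp.ne_zero
  rw [jordanConv_apply, Nat.sum_divisors_prime_pow hp, Finset.sum_range_succ,
    Finset.sum_range_succ, Finset.sum_eq_zero]
  · rw [Nat.div_self (pow_pos hp.pos _), Nat.pow_div (by omega) hp.pos, show k + 1 - k = 1 by omega,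
      pow_one, moebius_apply_prime hp]
    simp
    field_simp
    ring
  · intro j hj
    rw [Finset.mem_range] at hj
    rw [Nat.pow_div (by omega) hp.pos, moebius_apply_prime_pow hp (by omega), if_neg (by omega)]
    simp

theorem jordanTotientTwo_eq_jordanConv {m : ℕ} (hm : m ≠ 0) : jordanTotientTwo m = jordanConv m := by
  have h : jordanConv = pmul ((pow 2 : ArithmeticFunction ℕ) : ArithmeticFunction ℚ)
      (prodPrimeFactors fun p => 1 - 1 / (p : ℚ) ^ 2) := by
    rw [IsMultiplicative.eq_iff_eq_on_prime_powers _ isMultiplicative_jordanConv _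
      (isMultiplicative_pow.natCast.pmul (IsMultiplicative.prodPrimeFactors _))]
    intro p k hp
    rcases k with _ | k
    · rw [pow_zero, isMultiplicative_jordanConv.map_one,
        (isMultiplicative_pow.natCast.pmul (IsMultiplicative.prodPrimeFactors _)).map_one]
    · rw [jordanConv_prime_pow hp, pmul_apply, prodPrimeFactors_apply (pow_ne_zero _ hp.ne_zero),
        Nat.primeFactors_prime_pow (by omega) hp]
      simp [pow_apply]
  rw [h, pmul_apply, prodPrimeFactors_apply hm, jordanTotientTwo]
  simp [pow_apply]

/-- `J₂(m) = ∑_{d ∣ m} d φ(d) φ(m / d)`. Writing `N` for the identity function, `φ * 1 = N` gives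
`(N φ) * N = N (φ * 1) = N²`, hence `J₂ = N² * μ = (N φ) * N * μ = (N φ) * φ`. -/
theorem jordanConv_eq_sum_totient (m : ℕ) :
    jordanConv m = ∑ d ∈ m.divisors, (d : ℚ) * d.totient * (m / d).totient := by
  let N : ArithmeticFunction ℚ := (ArithmeticFunction.id : ArithmeticFunction ℕ)
  have hT : totientArith * (zeta : ArithmeticFunction ℚ) = N := by
    ext m
    rw [coe_mul_zeta_apply]
    simp only [N, totientArith, coe_mk, natCoe_apply, id_apply]
    exact_mod_cast Nat.sum_totient m
  have h : pmul N totientArith * N = (pow 2 : ArithmeticFunction ℕ) := by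
    ext m
    rw [mul_apply]
    have h1 : ∀ x ∈ m.divisorsAntidiagonal, (pmul N totientArith) x.1 * N x.2 =
        (m : ℚ) * (totientArith x.1 * (zeta : ArithmeticFunction ℚ) x.2) := by
      intro x hx
      have h1 := Nat.mem_divisorsAntidiagonal.1 hx
      have h2 : x.2 ≠ 0 := by
        rintro h
        rw [h, mul_zero] at h1
        exact h1.2 h1.1.symm
      rw [← h1.1]
      simp [N, natCoe_apply, h2]
      ring
    rw [Finset.sum_congr rfl h1, ← Finset.mul_sum, ← mul_apply, hT]
    simp [N, pow_apply, sq]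
  have h2 : jordanConv = pmul N totientArith * totientArith := by
    rw [jordanConv, ← h, ← hT]
    rw [show ∀ a b c d : ArithmeticFunction ℚ, a * (b * (c * d)) = (b * c) * (d * a) by
      intros; ring, coe_zeta_mul_coe_moebius, mul_one]
  rw [h2, mul_apply,
    Nat.sum_divisorsAntidiagonal (f := fun a b => (pmul N totientArith) a * totientArith b)]
  refine Finset.sum_congr rfl fun d _ => ?_
  rw [pmul_apply]
  simp [N, totientArith]

/-- The divisors of `2 ^ k * m` with odd cofactor are those divisible by the full power of `2`. -/
theorem sum_divisors_odd_cofactor (k m : ℕ) (hm : Odd m) (f : ℕ → ℚ) :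
    (∑ d ∈ (2 ^ k * m).divisors, if Odd (2 ^ k * m / d) then f d else 0) =
      ∑ d ∈ m.divisors, f (2 ^ k * d) := by
  have hm0 : m ≠ 0 := by rintro rfl; simp at hm
  rw [← Finset.sum_filter]
  symm
  refine Finset.sum_nbij (fun d => 2 ^ k * d) ?_ ?_ ?_ (fun _ _ => rfl)
  · intro d hd
    have hd := Nat.dvd_of_mem_divisors hd
    simp only [Finset.mem_filter, Nat.mem_divisors]
    refine ⟨⟨mul_dvd_mul_left _ hd, by positivity⟩, ?_⟩
    rw [Nat.mul_div_mul_left _ _ (by positivity)]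
    exact hm.of_dvd_nat (Nat.div_dvd_of_dvd hd)
  · intro a _ b _ h
    exact Nat.eq_of_mul_eq_mul_left (by positivity) h
  · intro d hd
    simp only [Finset.coe_filter, Nat.mem_divisors, Set.mem_ofPred_eq] at hd
    obtain ⟨⟨⟨c, hc⟩, -⟩, hodd⟩ := hd
    have hd0 : d ≠ 0 := by rintro rfl; simp [hm0] at hc
    rw [hc, Nat.mul_div_cancel_left _ (Nat.pos_of_ne_zero hd0)] at hodd
    have h1 : 2 ^ k ∣ d := by
      refine Nat.Coprime.dvd_of_dvd_mul_right (m := d) (n := c) ?_ (hc ▸ dvd_mul_right _ _)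
      exact Nat.Coprime.pow_left _ (Nat.coprime_two_left.2 hodd)
    obtain ⟨b, rfl⟩ := h1
    refine ⟨b, ?_, rfl⟩
    simp only [Finset.mem_coe, Nat.mem_divisors]
    refine ⟨⟨c, ?_⟩, hm0⟩
    rw [mul_assoc] at hc
    exact Nat.eq_of_mul_eq_mul_left (by positivity) hc

theorem not_even_and_odd_of_even_or_odd {m e d : ℕ} (h : Even e ∨ Odd m) (hd : d ∣ m) :
    ¬ (Even d ∧ Odd (m * e / d)) := by
  rintro ⟨h1, h2⟩
  rcases h with h | h
  · rw [← Nat.div_mul_right_comm hd] at h2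
    exact (Nat.not_even_iff_odd.2 h2) (h.mul_left _)
  · exact Nat.not_even_iff_odd.2 (h.of_dvd_nat hd) h1

/-- For `m` even and `e` odd, the exceptional divisors are those divisible by the full power of `2`
dividing `m`. -/
theorem even_and_odd_iff {m e d : ℕ} (he : Odd e) (hm : Even m) (hd : d ∣ m) :
    (Even d ∧ Odd (m * e / d)) ↔ Odd (m / d) := by
  rw [← Nat.div_mul_right_comm hd, Nat.odd_mul]
  refine ⟨fun h => h.2.1, fun h => ⟨?_, h, he⟩⟩
  rw [← Nat.div_mul_cancel hd, Nat.even_mul] at hm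
  exact hm.resolve_left (Nat.not_even_iff_odd.2 h)

theorem jordanConv_two_pow_mul {k m : ℕ} (hm : Odd m) :
    jordanConv (2 ^ (k + 1) * m) = 3 * (2 ^ k) ^ 2 * jordanConv m := by
  rw [isMultiplicative_jordanConv.map_mul_of_coprime
    (Nat.Coprime.pow_left _ (Nat.coprime_two_left.2 hm)), jordanConv_prime_pow Nat.prime_two]
  push_cast
  ring

theorem weightedJordan_eq {m e : ℕ} (hm : 0 < m) :
    weightedJordan m e =
      if Even e ∨ Odd m then jordanTotientTwo m else 1 / 3 * jordanTotientTwo m := by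
  rw [jordanTotientTwo_eq_jordanConv hm.ne']
  split_ifs with h
  · rw [jordanConv_apply, weightedJordan]
    refine Finset.sum_congr rfl fun d hd => ?_
    rw [divisorWeight, if_neg (not_even_and_odd_of_even_or_odd h (Nat.dvd_of_mem_divisors hd)),
      mul_one]
  · push Not at h
    rw [Nat.not_even_iff_odd, Nat.not_odd_iff_even] at h
    have h1 : weightedJordan m e = jordanConv m -
        ∑ d ∈ m.divisors, if Odd (m / d) then 1 / 2 * ((moebius (m / d) : ℚ) * (d : ℚ) ^ 2)
          else 0 := by
      rw [jordanConv_apply, weightedJordan, ← Finset.sum_sub_distrib]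
      refine Finset.sum_congr rfl fun d hd => ?_
      simp only [divisorWeight, even_and_odd_iff h.1 h.2 (Nat.dvd_of_mem_divisors hd)]
      split_ifs <;> ring
    obtain ⟨k, m', hm', rfl⟩ := Nat.exists_eq_two_pow_mul_odd hm.ne'
    obtain ⟨k, rfl⟩ : ∃ j, k = j + 1 := Nat.exists_eq_succ_of_ne_zero (by
      rintro rfl
      exact Nat.not_even_iff_odd.2 hm' (by simpa using h.2))
    rw [h1, sum_divisors_odd_cofactor _ _ hm'
      (fun d => 1 / 2 * ((moebius (2 ^ (k + 1) * m' / d) : ℚ) * (d : ℚ) ^ 2)),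
      jordanConv_two_pow_mul hm']
    have h2 : ∀ d, (1 / 2 : ℚ) * ((moebius (2 ^ (k + 1) * m' / (2 ^ (k + 1) * d)) : ℚ) *
        ((2 ^ (k + 1) * d : ℕ) : ℚ) ^ 2) = 2 * (2 ^ k) ^ 2 * ((moebius (m' / d) : ℚ) * (d : ℚ) ^ 2) := by
      intro d
      rw [Nat.mul_div_mul_left _ _ (by positivity)]
      push_cast
      ring
    simp only [h2]
    rw [← Finset.mul_sum, ← jordanConv_apply]
    ring

/-- In `F(m, e)` the weight `1 / 2` of the exceptional divisors can be traded for `0`: for `m = 2 ^ k * m'`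
with `k ≥ 1` and `m'` odd, halving those terms of `∑ μ(m / d) d²` and dropping those terms of
`∑ d φ(d) φ(m / d)` both remove `2 ^ (2 * k - 1) * J₂(m')` from `J₂(m)`. -/
theorem weightedJordan_eq_sum_totient {m e : ℕ} (hm : 0 < m) :
    weightedJordan m e = ∑ d ∈ m.divisors,
      if Even d ∧ Odd (m * e / d) then 0 else (d : ℚ) * d.totient * (m / d).totient := by
  rw [weightedJordan_eq hm, jordanTotientTwo_eq_jordanConv hm.ne']
  split_ifs with h
  · rw [jordanConv_eq_sum_totient]
    refine Finset.sum_congr rfl fun d hd => ?_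
    rw [if_neg (not_even_and_odd_of_even_or_odd h (Nat.dvd_of_mem_divisors hd))]
  · push Not at h
    rw [Nat.not_even_iff_odd, Nat.not_odd_iff_even] at h
    have h1 : (∑ d ∈ m.divisors,
        if Even d ∧ Odd (m * e / d) then 0 else (d : ℚ) * d.totient * (m / d).totient) =
        jordanConv m -
        ∑ d ∈ m.divisors, if Odd (m / d) then (d : ℚ) * d.totient * (m / d).totient else 0 := by
      rw [jordanConv_eq_sum_totient, ← Finset.sum_sub_distrib]
      refine Finset.sum_congr rfl fun d hd => ?_
      simp only [even_and_odd_iff h.1 h.2 (Nat.dvd_of_mem_divisors hd)]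
      split_ifs <;> ring
    rw [h1]
    obtain ⟨k, m', hm', rfl⟩ := Nat.exists_eq_two_pow_mul_odd hm.ne'
    obtain ⟨k, rfl⟩ : ∃ j, k = j + 1 := Nat.exists_eq_succ_of_ne_zero (by
      rintro rfl
      exact Nat.not_even_iff_odd.2 hm' (by simpa using h.2))
    rw [sum_divisors_odd_cofactor _ _ hm'
      (fun d => (d : ℚ) * d.totient * (2 ^ (k + 1) * m' / d).totient),
      jordanConv_two_pow_mul hm']
    have h2 : ∀ d ∈ m'.divisors, ((2 ^ (k + 1) * d : ℕ) : ℚ) * (2 ^ (k + 1) * d).totient *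
        (2 ^ (k + 1) * m' / (2 ^ (k + 1) * d)).totient =
        2 * (2 ^ k) ^ 2 * ((d : ℚ) * d.totient * (m' / d).totient) := by
      intro d hd
      rw [Nat.mul_div_mul_left _ _ (by positivity), Nat.totient_mul (Nat.Coprime.pow_left _
        (Nat.coprime_two_left.2 (hm'.of_dvd_nat (Nat.dvd_of_mem_divisors hd)))),
        Nat.totient_prime_pow_succ Nat.prime_two]
      push_cast
      ring
    rw [Finset.sum_congr rfl h2, ← Finset.mul_sum, ← jordanConv_eq_sum_totient]
    ring

end JordanTotient

/-! ### Multisets of residues with sum zero -/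

/-- Multiplicity functions `f` of the multisets of `n` elements of `ℤ_n` with sum `0`. -/
def zeroSumMultisets (n : ℕ) [NeZero n] : Finset (ZMod n → ℕ) :=
  (Finset.piAntidiag Finset.univ n).filter fun f => ∑ a, (f a : ZMod n) * a = 0

theorem mem_zeroSumMultisets {n : ℕ} [NeZero n] {f : ZMod n → ℕ} :
    f ∈ zeroSumMultisets n ↔ ∑ a, f a = n ∧ ∑ a, (f a : ZMod n) * a = 0 := by
  simp [zeroSumMultisets]

theorem PowerSeries.coeff_prod_univ {R ι : Type*} [CommSemiring R] [Fintype ι] [DecidableEq ι]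
    (F : ι → PowerSeries R) (d : ℕ) :
    PowerSeries.coeff d (∏ j, F j) =
      ∑ f ∈ Finset.piAntidiag Finset.univ d, ∏ i, PowerSeries.coeff (f i) (F i) := by
  rw [PowerSeries.coeff_prod]
  refine Finset.sum_nbij (fun l => (l : ι → ℕ)) ?_ ?_ ?_ (fun _ _ => rfl)
  · intro l hl
    simpa using hl
  · intro a _ b _ h
    exact DFunLike.coe_injective h
  · intro f hf
    exact ⟨Finsupp.equivFunOnFinite.symm f, by simpa using hf, by simp⟩

theorem IsPrimitiveRoot.prod_range_one_sub {ζ : ℂ} {r : ℕ} (hr : 0 < r) (h : IsPrimitiveRoot ζ r) :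
    ∏ i ∈ Finset.range r, (1 - PowerSeries.C (ζ ^ i) * PowerSeries.X) =
      1 - (PowerSeries.X : PowerSeries ℂ) ^ r := by
  have h' : IsPrimitiveRoot (PowerSeries.C ζ) r := h.map_of_injective PowerSeries.C_injective
  have := h'.pow_sub_pow_eq_prod_sub_mul 1 PowerSeries.X hr
  rw [one_pow] at this
  rw [this]
  refine Finset.prod_nbij (fun i => PowerSeries.C ζ ^ i) ?_ ?_ ?_ (fun i _ => by rw [map_pow])
  · intro i _
    rw [Polynomial.mem_nthRootsFinset hr, ← pow_mul, mul_comm, pow_mul, h'.pow_eq_one, one_pow]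
  · intro i hi j hj hij
    exact h'.pow_inj (by simpa using hi) (by simpa using hj) hij
  · intro ξ hξ
    have : NeZero r := ⟨hr.ne'⟩
    obtain ⟨i, hi, rfl⟩ := h'.eq_pow_of_pow_eq_one
      ((Polynomial.mem_nthRootsFinset hr _).1 hξ)
    exact ⟨i, by simpa using hi, rfl⟩

theorem IsPrimitiveRoot.prod_range_mul_one_sub {ζ : ℂ} {r : ℕ} (hr : 0 < r)
    (h : IsPrimitiveRoot ζ r) (g : ℕ) :
    ∏ i ∈ Finset.range (r * g), (1 - PowerSeries.C (ζ ^ i) * PowerSeries.X) =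
      (1 - (PowerSeries.X : PowerSeries ℂ) ^ r) ^ g := by
  induction g with
  | zero => simp
  | succ g ih =>
    rw [mul_add, mul_one, Finset.prod_range_add, ih, pow_succ, ← h.prod_range_one_sub hr]
    simp only [pow_add, pow_mul, h.pow_eq_one, one_pow, one_mul]

/-- For `ζ` a primitive `r`-th root of unity, the complete homogeneous symmetric polynomial of degree
`r * j` in the `r * g` powers of `ζ` is the coefficient of `X ^ (r * j)` in `(1 - X ^ r)⁻ᵍ`. -/
theorem IsPrimitiveRoot.coeff_prod_geometric {ζ : ℂ} {r : ℕ} (hr : 0 < r)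
    (h : IsPrimitiveRoot ζ r) (g j : ℕ) (hg : 0 < g) :
    PowerSeries.coeff (r * j)
        (∏ i ∈ Finset.range (r * g), PowerSeries.mk fun k => (ζ ^ i) ^ k) =
      (Nat.choose (g - 1 + j) (g - 1) : ℂ) := by
  have h1 : ∀ a : ℂ,
      (PowerSeries.mk fun k => a ^ k) * (1 - PowerSeries.C a * PowerSeries.X) = 1 := by
    intro a
    have := congrArg (PowerSeries.rescale a) (PowerSeries.mk_one_mul_one_sub_eq_one ℂ)
    rw [map_mul, map_sub, map_one, PowerSeries.rescale_X] at this
    convert this using 2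
    ext k
    simp [PowerSeries.coeff_rescale]
  have h2 : (∏ i ∈ Finset.range (r * g), PowerSeries.mk fun k => (ζ ^ i) ^ k) *
      (1 - (PowerSeries.X : PowerSeries ℂ) ^ r) ^ g = 1 := by
    rw [← h.prod_range_mul_one_sub hr, ← Finset.prod_mul_distrib]
    exact Finset.prod_eq_one fun i _ => h1 _
  obtain ⟨g, rfl⟩ : ∃ k, g = k + 1 := ⟨g - 1, by omega⟩
  have h3 := congrArg (PowerSeries.expand r hr.ne')
    (PowerSeries.mk_add_choose_mul_one_sub_pow_eq_one ℂ g)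
  rw [map_mul, map_pow, map_sub, map_one, PowerSeries.expand_X] at h3
  have h4 : (∏ i ∈ Finset.range (r * (g + 1)), PowerSeries.mk fun k => (ζ ^ i) ^ k) =
      PowerSeries.expand r hr.ne' (PowerSeries.mk fun n => (Nat.choose (g + n) g : ℂ)) :=
    left_inv_eq_right_inv h2 (by rw [mul_comm, h3])
  rw [h4, PowerSeries.coeff_expand_mul, PowerSeries.coeff_mk, Nat.add_sub_cancel]

theorem isPrimitiveRoot_stdAddChar {n : ℕ} [NeZero n] (k : ZMod n) :
    IsPrimitiveRoot (ZMod.stdAddChar k : ℂ) (addOrderOf k) := by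
  rw [IsPrimitiveRoot.iff_def]
  have h : ∀ l : ℕ, (ZMod.stdAddChar k : ℂ) ^ l = 1 ↔ addOrderOf k ∣ l := by
    intro l
    rw [← AddChar.map_nsmul_eq_pow, ← AddChar.map_zero_eq_one (ZMod.stdAddChar (N := n)),
      ZMod.injective_stdAddChar.eq_iff, addOrderOf_dvd_iff_nsmul_eq_zero]
  exact ⟨(h _).2 dvd_rfl, fun l hl => (h l).1 hl⟩

theorem prod_zmod_eq_prod_range {M : Type*} [CommMonoid M] {n : ℕ} [NeZero n] (F : ℕ → M) :
    ∏ a : ZMod n, F a.val = ∏ i ∈ Finset.range n, F i := by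
  refine Finset.prod_nbij (fun a => a.val) ?_ ?_ ?_ (fun _ _ => rfl)
  · intro a _
    simpa using ZMod.val_lt a
  · intro a _ b _ hab
    exact ZMod.val_injective n hab
  · intro i hi
    exact ⟨(i : ZMod n), by simp, ZMod.val_natCast_of_lt (by simpa using hi)⟩

theorem AddChar.map_sum_eq_prod {A M ι : Type*} [AddCommMonoid A] [CommMonoid M] (ψ : AddChar A M)
    (s : Finset ι) (f : ι → A) : ψ (∑ i ∈ s, f i) = ∏ i ∈ s, ψ (f i) := by
  classical
  induction s using Finset.induction_on with
  | empty => simp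
  | insert a s ha ih => rw [Finset.sum_insert ha, Finset.prod_insert ha, ψ.map_add_eq_mul, ih]

/-- The character sum of `x ↦ ψ(k x)` over the sums of all multisets of `n` elements of `ℤ_n`. It is the
coefficient of `X ^ n` in `∏ₐ (1 - ψ(k a) X)⁻¹ = (1 - X ^ r)^(-n / r)`, where `r` is the order of
`k`. -/
theorem sum_piAntidiag_stdAddChar {n : ℕ} [NeZero n] (k : ZMod n) :
    ∑ f ∈ Finset.piAntidiag (Finset.univ : Finset (ZMod n)) n,
        (ZMod.stdAddChar (k * ∑ a, (f a : ZMod n) * a) : ℂ) =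
      (Nat.choose (2 * (n / addOrderOf k) - 1) (n / addOrderOf k) : ℂ) := by
  have hn : 0 < n := Nat.pos_of_neZero n
  have hr : 0 < addOrderOf k := addOrderOf_pos k
  obtain ⟨g, hg⟩ : addOrderOf k ∣ n := by
    simpa using addOrderOf_dvd_natCard k
  have hg0 : 0 < g := Nat.pos_of_ne_zero (by rintro rfl; simp at hg; omega)
  have h1 : ∀ f : ZMod n → ℕ, (ZMod.stdAddChar (k * ∑ a, (f a : ZMod n) * a) : ℂ) =
      ∏ a : ZMod n, PowerSeries.coeff (f a)
        (PowerSeries.mk fun j => ((ZMod.stdAddChar k : ℂ) ^ a.val) ^ j) := by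
    intro f
    rw [Finset.mul_sum, AddChar.map_sum_eq_prod]
    refine Finset.prod_congr rfl fun a _ => ?_
    rw [PowerSeries.coeff_mk, ← AddChar.map_nsmul_eq_pow, ← AddChar.map_nsmul_eq_pow]
    congr 1
    simp
    ring
  rw [Finset.sum_congr rfl fun f _ => h1 f, ← PowerSeries.coeff_prod_univ,
    prod_zmod_eq_prod_range fun i => PowerSeries.mk fun j => ((ZMod.stdAddChar k : ℂ) ^ i) ^ j]
  have h2 := (isPrimitiveRoot_stdAddChar k).coeff_prod_geometric hr g g hg0
  rw [← hg] at h2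
  rw [h2, Nat.div_eq_of_eq_mul_right hr hg, show 2 * g - 1 = g - 1 + g by omega,
    Nat.choose_symm_add]

theorem sum_zmod_addOrderOf {M : Type*} [AddCommMonoid M] {n : ℕ} [NeZero n] (G : ℕ → M) :
    ∑ k : ZMod n, G (addOrderOf k) = ∑ d ∈ n.divisors, d.totient • G d := by
  have h : ∀ k ∈ (Finset.univ : Finset (ZMod n)), addOrderOf k ∈ n.divisors := fun k _ => by
    simpa [NeZero.ne n] using addOrderOf_dvd_natCard k
  rw [← Finset.sum_fiberwise_of_maps_to h]
  refine Finset.sum_congr rfl fun d hd => ?_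
  rw [Finset.sum_congr rfl fun k hk => by rw [(Finset.mem_filter.1 hk).2], Finset.sum_const,
    IsAddCyclic.card_addOrderOf_eq_totient (by simpa using Nat.dvd_of_mem_divisors hd)]

/-- The number of multisets of `n` elements of `ℤ_n` with sum `0`, by orthogonality of characters. -/
theorem card_zeroSumMultisets_mul (n : ℕ) [NeZero n] :
    (zeroSumMultisets n).card * n =
      ∑ r ∈ n.divisors, r.totient * Nat.choose (2 * (n / r) - 1) (n / r) := by
  have h1 : ∀ f : ZMod n → ℕ, ∑ k : ZMod n,
      (ZMod.stdAddChar (k * ∑ a, (f a : ZMod n) * a) : ℂ) =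
        if ∑ a, (f a : ZMod n) * a = 0 then (n : ℂ) else 0 := by
    intro f
    rw [AddChar.sum_mulShift _ (ZMod.isPrimitive_stdAddChar n), ZMod.card]
    split_ifs <;> simp
  have h2 : ((zeroSumMultisets n).card * n : ℂ) =
      ∑ k : ZMod n, (Nat.choose (2 * (n / addOrderOf k) - 1) (n / addOrderOf k) : ℂ) := by
    rw [← Finset.sum_congr rfl fun k _ => sum_piAntidiag_stdAddChar k, Finset.sum_comm,
      Finset.sum_congr rfl fun f _ => h1 f, ← Finset.sum_filter, Finset.sum_const, nsmul_eq_mul]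
    rfl
  rw [sum_zmod_addOrderOf fun r => (Nat.choose (2 * (n / r) - 1) (n / r) : ℂ)] at h2
  simp only [nsmul_eq_mul] at h2
  exact_mod_cast h2

/-! ### Orbits of the action and translation classes of multisets -/

theorem exists_perm_of_card_fiber_eq {ι α : Type*} [Fintype ι] [DecidableEq α] {u v : ι → α}
    (h : ∀ a, (Finset.univ.filter fun i => u i = a).card =
      (Finset.univ.filter fun i => v i = a).card) :
    ∃ π : Equiv.Perm ι, ∀ i, u i = v (π i) := by
  have e : ∀ a, Nonempty ({i // u i = a} ≃ {i // v i = a}) := fun a =>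
    ⟨Fintype.equivOfCardEq (by rw [Fintype.card_subtype, Fintype.card_subtype, h a])⟩
  exact ⟨Equiv.ofFiberEquiv fun a => (e a).some, fun i => (Equiv.ofFiberEquiv_map _ i).symm⟩

theorem exists_card_fiber_eq {α : Type*} [Fintype α] [DecidableEq α] {n : ℕ} (f : α → ℕ)
    (h : ∑ a, f a = n) : ∃ u : Fin n → α,
    ∀ a, (Finset.univ.filter fun i => u i = a).card = f a := by
  have e : Nonempty (Fin n ≃ Σ a, Fin (f a)) := ⟨Fintype.equivOfCardEq (by simp [h])⟩
  obtain ⟨e⟩ := e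
  refine ⟨fun i => (e i).1, fun a => ?_⟩
  rw [← Fintype.card_subtype,
    Fintype.card_congr (e.subtypeEquiv (q := fun s => s.1 = a) fun i => Iff.rfl),
    Fintype.card_congr (Equiv.sigmaSubtype (β := fun a => Fin (f a)) a), Fintype.card_fin]

/-- Translation of multisets: `y` moves each element `a` to `a + y`. The sum of a multiset of `n`
elements changes by `n y = 0`. -/
instance translationAction (n : ℕ) [NeZero n] : AddAction (ZMod n) (zeroSumMultisets n) where
  vadd y f := ⟨fun a => f.1 (a - y), by
    have hf := mem_zeroSumMultisets.1 f.2
    rw [mem_zeroSumMultisets]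
    constructor
    · exact ((Equiv.subRight y).sum_comp f.1).trans hf.1
    · have h := (Equiv.subRight y).sum_comp fun a => (f.1 a : ZMod n) * (a + y)
      simp only [Equiv.subRight_apply, sub_add_cancel] at h
      rw [h]
      simp only [mul_add, Finset.sum_add_distrib, hf.2, zero_add]
      rw [← Finset.sum_mul, ← Nat.cast_sum, hf.1]
      simp⟩
  zero_vadd f := Subtype.ext (funext fun a => congrArg f.1 (sub_zero a))
  add_vadd y z f := Subtype.ext (funext fun a => congrArg f.1 (by abel))

/-- The multiset of entries of an element of `extendedPF n n`. -/
def entryMultiset {n : ℕ} [NeZero n] (x : extendedPF n n) : zeroSumMultisets n :=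
  ⟨fun a => (Finset.univ.filter fun i => x.1 i = a).card, by
    rw [mem_zeroSumMultisets]
    constructor
    · rw [← Finset.card_eq_sum_card_fiberwise (fun _ _ => Finset.mem_univ _)]
      simp
    · have h := x.2.2
      rw [← Finset.sum_fiberwise Finset.univ x.1] at h
      rw [CharP.cast_eq_zero] at h
      rw [← h]
      refine Finset.sum_congr rfl fun a _ => ?_
      rw [Finset.sum_congr rfl fun i hi => (Finset.mem_filter.1 hi).2, Finset.sum_const,
        nsmul_eq_mul]⟩

theorem card_filter_add_perm {n : ℕ} (x : Fin n → ZMod n) (y : ZMod n) (π : Equiv.Perm (Fin n))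
    (a : ZMod n) : (Finset.univ.filter fun i => y + x (π i) = a).card =
      (Finset.univ.filter fun i => x i = a - y).card := by
  refine Finset.card_equiv π fun i => ?_
  simp [eq_sub_iff_add_eq, add_comm]

theorem entryMultiset_orbitRel {n : ℕ} [NeZero n] (x x' : extendedPF n n) :
    MulAction.orbitRel (Equiv.Perm (Fin n))ᵐᵒᵖ _ x x' ↔
      AddAction.orbitRel (ZMod n) _ (entryMultiset x) (entryMultiset x') := by
  rw [MulAction.orbitRel_apply, AddAction.orbitRel_apply]
  constructor
  · rintro ⟨g, rfl⟩
    refine ⟨parkingShift g.unop x'.1, Subtype.ext (funext fun a => ?_)⟩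
    exact (card_filter_add_perm x'.1 _ g.unop a).symm
  · rintro ⟨y, hy⟩
    have h : ∀ a, (Finset.univ.filter fun i => x.1 i = a).card =
        (Finset.univ.filter fun i => y + x'.1 i = a).card := by
      intro a
      have h1 := congrFun (congrArg Subtype.val hy) a
      exact h1.symm.trans (card_filter_add_perm x'.1 y 1 a).symm
    obtain ⟨π, hπ⟩ := exists_perm_of_card_fiber_eq h
    exact ⟨MulOpposite.op π, tau_eq π x' x y hπ⟩

theorem exists_entryMultiset_orbitRel {n : ℕ} [NeZero n] (f : zeroSumMultisets n) :
    ∃ x : extendedPF n n, AddAction.orbitRel (ZMod n) _ (entryMultiset x) f := by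
  have hf := mem_zeroSumMultisets.1 f.2
  obtain ⟨u, hu⟩ := exists_card_fiber_eq f.1 hf.1
  obtain ⟨y, hy, -⟩ := existsUnique_shift_perm 1 u
  have hsum : ∑ i, u i = 0 := by
    rw [← Finset.sum_fiberwise Finset.univ u, ← hf.2]
    refine Finset.sum_congr rfl fun a _ => ?_
    rw [Finset.sum_congr rfl fun i hi => (Finset.mem_filter.1 hi).2, Finset.sum_const,
      nsmul_eq_mul, hu]
  refine ⟨⟨fun i => y + u ((1 : Equiv.Perm (Fin n)) i), hy, ?_⟩, ?_⟩
  · rw [sum_shift_perm, hsum, CharP.cast_eq_zero]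
  · rw [AddAction.orbitRel_apply]
    refine ⟨y, Subtype.ext (funext fun a => ?_)⟩
    exact (hu _).symm.trans (card_filter_add_perm u y 1 a).symm

/-- Up to reordering, an element of `extendedPF n n` is a multiset with sum `0`, and each translation
class of sequences contains elements of `extendedPF n n`; the orbits of `τ` are therefore the
translation classes of multisets. -/
theorem orbitCount_eq_card_translation_orbits (n : ℕ) [NeZero n] :
    orbitCount n n = Nat.card (AddAction.orbitRel.Quotient (ZMod n) (zeroSumMultisets n)) := by
  refine Nat.card_eq_of_bijective
    (Quotient.map' entryMultiset fun x x' h => (entryMultiset_orbitRel x x').1 h) ⟨?_, ?_⟩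
  · rintro ⟨x⟩ ⟨x'⟩ h
    exact Quotient.sound' ((entryMultiset_orbitRel x x').2 (Quotient.exact' h))
  · rintro ⟨f⟩
    obtain ⟨x, hx⟩ := exists_entryMultiset_orbitRel f
    exact ⟨Quotient.mk'' x, Quotient.sound' hx⟩

/-! ### Multisets fixed by a translation -/

/-- The subgroup generated by an element of order `d` is generated by `n / d`. -/
theorem zmultiples_eq_zmultiples_natCast {n : ℕ} [NeZero n] (y : ZMod n) :
    AddSubgroup.zmultiples y = AddSubgroup.zmultiples ((n / addOrderOf y : ℕ) : ZMod n) := by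
  have hn : n ≠ 0 := NeZero.ne n
  have h : n / addOrderOf y = n.gcd y.val := by
    conv_lhs => rw [← ZMod.natCast_zmod_val y, ZMod.addOrderOf_coe _ hn]
    exact Nat.div_div_self (Nat.gcd_dvd_left _ _) hn
  rw [h]
  apply le_antisymm
  · rw [AddSubgroup.zmultiples_le]
    obtain ⟨c, hc⟩ := Nat.gcd_dvd_right n y.val
    refine ⟨c, ?_⟩
    have h1 : ((y.val : ℕ) : ZMod n) = ((n.gcd y.val * c : ℕ) : ZMod n) := congrArg _ hc
    rw [ZMod.natCast_zmod_val] at h1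
    refine Eq.trans ?_ h1.symm
    simp [mul_comm]
  · rw [AddSubgroup.zmultiples_le]
    refine ⟨Nat.gcdB n y.val, ?_⟩
    have h1 := congrArg (Int.cast : ℤ → ZMod n) (Nat.gcd_eq_gcd_ab n y.val)
    push_cast at h1
    rw [h1, ZMod.natCast_zmod_val]
    simp [mul_comm]

theorem sum_range_mul_eq {M : Type*} [AddCommMonoid M] (e d : ℕ) (h : ℕ → M) :
    ∑ i ∈ Finset.range (e * d), h i =
      ∑ j ∈ Finset.range d, ∑ b ∈ Finset.range e, h (e * j + b) := by
  induction d with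
  | zero => simp
  | succ d ih => rw [mul_add, mul_one, Finset.sum_range_add, ih, Finset.sum_range_succ]

theorem sum_zmod_eq_sum_range {M : Type*} [AddCommMonoid M] {n : ℕ} [NeZero n] (F : ZMod n → M) :
    ∑ a, F a = ∑ i ∈ Finset.range n, F (i : ZMod n) := by
  have h := prod_zmod_eq_prod_range (M := Multiplicative M) (n := n) fun i =>
    Multiplicative.ofAdd (F (i : ZMod n))
  simp only [ZMod.natCast_zmod_val] at h
  exact h

/-- The pullback of a multiplicity function along the reduction `ℤ_n → ℤ_e`. The functions obtained in
this way are those of period `e`. -/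
def pullbackMultiplicity {n e : ℕ} (h : e ∣ n) (g : ZMod e → ℕ) : ZMod n → ℕ :=
  fun a => g (ZMod.castHom h (ZMod e) a)

theorem pullbackMultiplicity_natCast {n e : ℕ} (h : e ∣ n) (g : ZMod e → ℕ) (j b : ℕ) :
    pullbackMultiplicity h g ((e * j + b : ℕ) : ZMod n) = g b := by
  rw [pullbackMultiplicity, map_natCast]
  simp

/-- The arithmetic behind `pullbackMultiplicity_mem_iff`: when `d` is even and `e` is odd, the second
summand is not divisible by `d`; otherwise it is divisible by `e * d`. -/
theorem dvd_iff_of_pullback {d e T : ℕ} (hd : 0 < d) :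
    e * d ∣ d * T + e * e * (∑ j ∈ Finset.range d, j) ↔ ¬ (Even d ∧ Odd e) ∧ e ∣ T := by
  have hC := Finset.sum_range_id_mul_two d
  set C := ∑ j ∈ Finset.range d, j
  by_cases h : Even d ∧ Odd e
  · simp only [h, and_self, not_true_eq_false, false_and, iff_false]
    obtain ⟨⟨c, rfl⟩, he⟩ := h
    intro hdvd
    have h1 : (c + c) ∣ e * e * C :=
      (Nat.dvd_add_right (dvd_mul_right _ T)).1 ((dvd_mul_left _ _).trans hdvd)
    have hC' : C = c * (c + c - 1) := by
      have : C * 2 = c * (c + c - 1) * 2 := by rw [hC]; ring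
      omega
    rw [hC', show e * e * (c * (c + c - 1)) = c * (e * e * (c + c - 1)) by ring,
      ← mul_two, Nat.mul_dvd_mul_iff_left (by omega)] at h1
    have h2 : Odd (e * e * (c * 2 - 1)) := (he.mul he).mul ⟨c - 1, by omega⟩
    exact Nat.not_even_iff_odd.2 h2 (even_iff_two_dvd.2 h1)
  · simp only [h, not_false_eq_true, true_and]
    have h1 : d ∣ e * C := by
      rw [not_and_or, Nat.not_even_iff_odd, Nat.not_odd_iff_even] at h
      rcases h with ⟨c, hc⟩ | ⟨c, hc⟩
      · refine Dvd.dvd.mul_left ⟨c, ?_⟩ _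
        have h2 : C * 2 = d * c * 2 := by
          rw [hC, show d - 1 = c * 2 by omega]
          ring
        omega
      · refine ⟨c * (d - 1), ?_⟩
        rw [hc, show (c + c) * C = c * (C * 2) by ring, hC]
        ring
    rw [Nat.dvd_add_left (by rw [mul_assoc]; exact mul_dvd_mul_left e h1), mul_comm e d,
      Nat.mul_dvd_mul_iff_left hd]

theorem sum_pullbackMultiplicity {n e d : ℕ} [NeZero n] [NeZero e] (h : e * d = n) (g : ZMod e → ℕ) :
    ∑ a, pullbackMultiplicity ⟨d, h.symm⟩ g a = d * ∑ b, g b := by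
  have hr : Finset.range n = Finset.range (e * d) := by rw [h]
  rw [sum_zmod_eq_sum_range, sum_zmod_eq_sum_range g, hr, sum_range_mul_eq]
  simp only [pullbackMultiplicity_natCast, Finset.sum_const, Finset.card_range, smul_eq_mul]

/-- The sum of a pulled back multiset: the class of `b` lifts to `b, e + b, …, (d - 1) e + b`, and the
original multiset has `e` elements. -/
theorem sum_pullbackMultiplicity_mul {n e d : ℕ} [NeZero n] [NeZero e] (h : e * d = n)
    (g : ZMod e → ℕ) (hg : ∑ b, g b = e) :
    ∑ a : ZMod n, ((pullbackMultiplicity ⟨d, h.symm⟩ g a : ℕ) : ZMod n) * a =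
      ((d * (∑ b ∈ Finset.range e, g (b : ZMod e) * b) +
        e * e * (∑ j ∈ Finset.range d, j) : ℕ) : ZMod n) := by
  rw [sum_zmod_eq_sum_range] at hg
  have hr : Finset.range n = Finset.range (e * d) := by rw [h]
  rw [sum_zmod_eq_sum_range, hr, sum_range_mul_eq]
  have h1 : ∀ j ∈ Finset.range d, ∑ b ∈ Finset.range e, g (b : ZMod e) * (e * j + b) =
      e * (e * j) + ∑ b ∈ Finset.range e, g (b : ZMod e) * b := by
    intro j _
    simp only [mul_add, Finset.sum_add_distrib]
    rw [← Finset.sum_mul, hg]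
  have h2 : d * (∑ b ∈ Finset.range e, g (b : ZMod e) * b) + e * e * (∑ j ∈ Finset.range d, j) =
      ∑ j ∈ Finset.range d, ∑ b ∈ Finset.range e, g (b : ZMod e) * (e * j + b) := by
    rw [Finset.sum_congr rfl h1, Finset.sum_add_distrib, Finset.sum_const, Finset.card_range,
      smul_eq_mul, ← Finset.mul_sum, ← Finset.mul_sum]
    ring
  rw [h2]
  simp only [pullbackMultiplicity_natCast]
  push_cast
  rfl

theorem pullbackMultiplicity_mem_iff {n e d : ℕ} [NeZero n] [NeZero e] (h : e * d = n)
    (g : ZMod e → ℕ) :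
    pullbackMultiplicity ⟨d, h.symm⟩ g ∈ zeroSumMultisets n ↔
      ¬ (Even d ∧ Odd e) ∧ g ∈ zeroSumMultisets e := by
  have hd : 0 < d := Nat.pos_of_ne_zero (by rintro rfl; exact NeZero.ne n (by simpa using h.symm))
  rw [mem_zeroSumMultisets, mem_zeroSumMultisets, sum_pullbackMultiplicity h, and_left_comm]
  have h0 : d * ∑ b, g b = n ↔ ∑ b, g b = e := by
    rw [← h, mul_comm e d]
    exact Nat.mul_right_inj hd.ne'
  rw [h0]
  refine and_congr_right fun hg => ?_
  rw [sum_pullbackMultiplicity_mul h g hg, ZMod.natCast_eq_zero_iff, ← h, dvd_iff_of_pullback hd,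
    sum_zmod_eq_sum_range, ← ZMod.natCast_eq_zero_iff]
  simp

theorem exists_pullbackMultiplicity_eq {n e : ℕ} [NeZero n] [NeZero e] (h : e ∣ n)
    (f : ZMod n → ℕ) (hf : ∀ a, f (a - (e : ZMod n)) = f a) :
    ∃ g, pullbackMultiplicity h g = f := by
  have h1 : ∀ j a, f (a + (e * j : ℕ)) = f a := by
    intro j
    induction j with
    | zero => simp
    | succ j ih =>
      intro a
      rw [← hf, ← ih a]
      congr 1
      push_cast
      ring
  refine ⟨fun b => f (b.val : ZMod n), funext fun a => ?_⟩
  have h2 : (ZMod.castHom h (ZMod e) a).val = a.val % e := by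
    conv_lhs => rw [← ZMod.natCast_zmod_val a, map_natCast, ZMod.val_natCast]
  rw [pullbackMultiplicity, h2, ← h1 (a.val / e), ← Nat.cast_add, Nat.mod_add_div,
    ZMod.natCast_zmod_val]

theorem pullbackMultiplicity_injective {n e : ℕ} (h : e ∣ n) :
    Function.Injective (pullbackMultiplicity h) := by
  intro g g' hg
  funext b
  obtain ⟨a, rfl⟩ := ZMod.castHom_surjective h b
  exact congrFun hg a

theorem mem_fixedBy_iff {n : ℕ} [NeZero n] (y : ZMod n) (f : zeroSumMultisets n) :
    f ∈ AddAction.fixedBy (zeroSumMultisets n) y ↔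
      ∀ a, f.1 (a - ((n / addOrderOf y : ℕ) : ZMod n)) = f.1 a := by
  have h : ∀ z : ZMod n, f ∈ AddAction.fixedBy (zeroSumMultisets n) z ↔
      AddSubgroup.zmultiples z ≤ AddAction.stabilizer (ZMod n) f := by
    intro z
    rw [AddSubgroup.zmultiples_le, AddAction.mem_stabilizer_iff, AddAction.mem_fixedBy]
  rw [h, zmultiples_eq_zmultiples_natCast, ← h, AddAction.mem_fixedBy]
  exact Subtype.ext_iff.trans funext_iff

/-- A translation of order `d` fixes the pullbacks of multisets of `e = n / d` elements of `ℤ_e`, and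
these pullbacks have sum `0` only if `d` is odd or `e` is even. -/
theorem card_fixedBy_mul {n : ℕ} [NeZero n] (y : ZMod n) :
    Nat.card (AddAction.fixedBy (zeroSumMultisets n) y) * (n / addOrderOf y) =
      if Even (addOrderOf y) ∧ Odd (n / addOrderOf y) then 0 else
        ∑ r ∈ (n / addOrderOf y).divisors,
          r.totient * Nat.choose (2 * (n / addOrderOf y / r) - 1) (n / addOrderOf y / r) := by
  have hdvd : addOrderOf y ∣ n := by simpa using addOrderOf_dvd_natCard y
  have hmem := mem_fixedBy_iff y
  generalize addOrderOf y = d at *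
  obtain ⟨e, he⟩ : ∃ e, n / d = e := ⟨_, rfl⟩
  rw [he] at hmem ⊢
  have h : e * d = n := by rw [← he, Nat.div_mul_cancel hdvd]
  have : NeZero e := ⟨by rintro rfl; exact NeZero.ne n (by simpa using h.symm)⟩
  split_ifs with hpar
  · have : IsEmpty (AddAction.fixedBy (zeroSumMultisets n) y) := by
      refine ⟨fun f => ?_⟩
      obtain ⟨g, hg⟩ := exists_pullbackMultiplicity_eq ⟨d, h.symm⟩ f.1.1 ((hmem f.1).1 f.2)
      have hf := f.1.2
      rw [← hg, pullbackMultiplicity_mem_iff h] at hf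
      exact hf.1 hpar
    simp
  · rw [← card_zeroSumMultisets_mul e]
    congr 1
    rw [← Fintype.card_coe, ← Nat.card_eq_fintype_card]
    symm
    refine Nat.card_eq_of_bijective (fun g => ⟨⟨pullbackMultiplicity ⟨d, h.symm⟩ g.1,
      (pullbackMultiplicity_mem_iff h g.1).2 ⟨hpar, g.2⟩⟩, (hmem _).2 fun a => ?_⟩) ⟨?_, ?_⟩
    · simp only [pullbackMultiplicity, map_sub, map_natCast, ZMod.natCast_self, sub_zero]
    · intro g g' hg
      exact Subtype.ext (pullbackMultiplicity_injective _
        (congrArg (fun f => f.1.1) hg))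
    · intro f
      obtain ⟨g, hg⟩ := exists_pullbackMultiplicity_eq ⟨d, h.symm⟩ f.1.1 ((hmem f.1).1 f.2)
      have hf := f.1.2
      rw [← hg, pullbackMultiplicity_mem_iff h] at hf
      exact ⟨⟨g, hf.2⟩, Subtype.ext (Subtype.ext hg)⟩

/-! ### Burnside's lemma -/

theorem sum_divisors_divisors_comm {M : Type*} [AddCommMonoid M] (n : ℕ) (K : ℕ → ℕ → ℕ → M) :
    ∑ d ∈ n.divisors, ∑ r ∈ (n / d).divisors, K d r (n / d / r) =
      ∑ g ∈ n.divisors, ∑ d ∈ (n / g).divisors, K d (n / g / d) g := by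
  have h1 : ∀ d ∈ n.divisors, ∑ r ∈ (n / d).divisors, K d r (n / d / r) =
      ∑ g ∈ (n / d).divisors, K d (n / g / d) g := by
    intro d _
    rw [← Nat.sum_div_divisors]
    refine Finset.sum_congr rfl fun g hg => ?_
    have hg := Nat.mem_divisors.1 hg
    rw [Nat.div_div_self hg.1 hg.2, Nat.div_div_eq_div_mul, Nat.div_div_eq_div_mul, mul_comm]
  rw [Finset.sum_congr rfl h1]
  have h2 : ∀ d g, (d ∈ n.divisors ∧ g ∈ (n / d).divisors) ↔ d * g ∣ n ∧ n ≠ 0 := by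
    intro d g
    simp only [Nat.mem_divisors]
    constructor
    · rintro ⟨⟨hd, h0⟩, hg, -⟩
      exact ⟨(Nat.dvd_div_iff_mul_dvd hd).1 hg, h0⟩
    · rintro ⟨hdg, h0⟩
      have hd := dvd_of_mul_right_dvd hdg
      exact ⟨⟨hd, h0⟩, (Nat.dvd_div_iff_mul_dvd hd).2 hdg, (Nat.div_ne_zero_iff_of_dvd hd).2
        ⟨h0, ne_zero_of_dvd_ne_zero h0 hd⟩⟩
  refine Finset.sum_comm' fun d g => ?_
  rw [h2, and_comm (a := d ∈ _), h2, mul_comm]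

/-- Burnside's lemma for the translation action. -/
theorem orbitCount_mul_eq (n : ℕ) [NeZero n] :
    (orbitCount n n : ℚ) * n = ∑ d ∈ n.divisors, ∑ r ∈ (n / d).divisors,
      (if Even d ∧ Odd (n / d) then 0 else (d : ℚ) * d.totient * r.totient *
        Nat.choose (2 * (n / d / r) - 1) (n / d / r)) / n := by
  classical
  have hn : (n : ℚ) ≠ 0 := by exact_mod_cast NeZero.ne n
  let φ : ℕ → ℚ := fun d => (d : ℚ) / n * if Even d ∧ Odd (n / d) then 0 else
    ∑ r ∈ (n / d).divisors, (r.totient : ℚ) * Nat.choose (2 * (n / d / r) - 1) (n / d / r)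
  have : Fintype (AddAction.orbitRel.Quotient (ZMod n) (zeroSumMultisets n)) := Fintype.ofFinite _
  have hB := AddAction.sum_card_fixedBy_eq_card_orbits_mul_card_addGroup (ZMod n)
    (zeroSumMultisets n)
  rw [← Nat.card_eq_fintype_card (α := Quotient _), ZMod.card] at hB
  have hφ : ∀ y : ZMod n,
      ((Fintype.card (AddAction.fixedBy (zeroSumMultisets n) y) : ℕ) : ℚ) = φ (addOrderOf y) := by
    intro y
    have hdvd : addOrderOf y ∣ n := by simpa using addOrderOf_dvd_natCard y
    have hd : (addOrderOf y : ℚ) ≠ 0 := by exact_mod_cast (addOrderOf_pos y).ne'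
    have h := congrArg (Nat.cast : ℕ → ℚ) (card_fixedBy_mul y)
    rw [Nat.card_eq_fintype_card, Nat.cast_mul, Nat.cast_div hdvd hd] at h
    push_cast at h
    simp only [φ]
    rw [← h]
    field_simp
  rw [orbitCount_eq_card_translation_orbits, ← Nat.cast_mul]
  refine (congrArg (Nat.cast : ℕ → ℚ) hB).symm.trans ?_
  rw [Nat.cast_sum, Finset.sum_congr rfl fun y _ => hφ y, sum_zmod_addOrderOf φ]
  refine Finset.sum_congr rfl fun d _ => ?_
  simp only [φ]
  split_ifs with h
  · simp
  · rw [nsmul_eq_mul, Finset.mul_sum, Finset.mul_sum]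
    refine Finset.sum_congr rfl fun r _ => ?_
    ring

theorem theorem5p2 (n : ℕ) [NeZero n] :
    (orbitCount n n : ℚ) =
        1 / (n : ℚ) ^ 2 *
          ∑ e ∈ n.divisors, (Nat.choose (2 * e - 1) e : ℚ) * weightedJordan (n / e) e ∧
      ∀ m e : ℕ, 0 < m → 0 < e →
        weightedJordan m e =
          if Even e ∨ Odd m then jordanTotientTwo m else 1 / 3 * jordanTotientTwo m := by
  refine ⟨?_, fun m e hm _ => weightedJordan_eq hm⟩
  have hn : (n : ℚ) ≠ 0 := by exact_mod_cast NeZero.ne n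
  have h := orbitCount_mul_eq n
  rw [sum_divisors_divisors_comm n fun d r g => (if Even d ∧ Odd (n / d) then 0 else
    (d : ℚ) * d.totient * r.totient * Nat.choose (2 * g - 1) g) / n] at h
  have h1 : ∀ g ∈ n.divisors, (∑ d ∈ (n / g).divisors, (if Even d ∧ Odd (n / d) then 0 else
      (d : ℚ) * d.totient * (n / g / d).totient * Nat.choose (2 * g - 1) g) / n) =
      (Nat.choose (2 * g - 1) g : ℚ) * weightedJordan (n / g) g / n := by
    intro g hg
    have hg := Nat.mem_divisors.1 hg
    rw [weightedJordan_eq_sum_totient (Nat.pos_of_ne_zero ((Nat.div_ne_zero_iff_of_dvd hg.1).2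
      ⟨hg.2, ne_zero_of_dvd_ne_zero hg.2 hg.1⟩)), Nat.div_mul_cancel hg.1, Finset.mul_sum,
      Finset.sum_div]
    refine Finset.sum_congr rfl fun d _ => ?_
    split_ifs <;> ring
  rw [Finset.sum_congr rfl h1, ← Finset.sum_div] at h
  field_simp at h ⊢
  linarith
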